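/- **Theorem (Consistency of the switch distribution, Part 2).** *Setting.* Let $\mathcal X\subseteq\mathbb R^d$ be a Borel set, with counting measure as dominating measure $\nu$ if $\mathcal X$ is countable, and Lebesgue measure otherwise. A *prediction strategy* $p$ assigns to every $n\ge 0$ and every past $x^n=(x_1,\dots,x_n)\in\mathcal X^n$ a probability density $p(\cdot\mid x^n)$ with respect to $\nu$ for the next outcome, jointly measurable in $x^n$ and the outcome. Its joint density is $p(x^n)=\prod_{i=1}^n p(x_i\mid x^{i-1})$; $P$ is the induced distribution of $X^\infty=(X_1,X_2,\dots)$, and $P(X_{n+1}^\infty\mid x^n)$ the induced distribution of the future outcomes given $x^n$. For $k\in\mathbb Z^+$ let $\mathcal M_k=\{p_\theta:\theta\in\Theta_k\}$ be a parametric model of prediction strategies, where $\Theta_k\subseteq\mathbb R^{d_k}$, $d_k\ge 0$, is a Borel set that differs from its interior by a set of Lebesgue measure $0$, and $p_\theta(x_{n+1}\mid x^n)$ is jointly measurable in $(\theta,x^{n+1})$. *Switch distribution.* Let $\mathbb S$ be the set of all finite sequences $\mathbf s=((t_1,k_1),\dots,(t_m,k_m))$ in $\mathbb N\times\mathbb Z^+$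 with $m=m(\mathbf s)\ge 1$ and $0=t_1<\dots<t_m$. Let $K_{n+1}(\mathbf s)=k_i$ for the largest $i$ with $t_i\le n$, and let $E_{\mathbf s}$ be the set of all $\mathbf s'\in\mathbb S$ with $m(\mathbf s')>m(\mathbf s)$ whose first $m(\mathbf s)$ entries are those of $\mathbf s$. Given prediction strategies $\bar p_1,\bar p_2,\dots$ (not necessarily Bayesian) and a probability mass function $\pi$ on $\mathbb S$, let $q_{\mathbf s}(x_{n+1}\mid x^n)=\bar p_{K_{n+1}(\mathbf s)}(x_{n+1}\mid x^n)$, and $$\pi(K_{n+1}=k\mid x^n)=\frac{\sum_{\mathbf s:\,K_{n+1}(\mathbf s)=k}q_{\mathbf s}(x^n)\,\pi(\mathbf s)}{\sum_{\mathbf s\in\mathbb S}q_{\mathbf s}(x^n)\,\pi(\mathbf s)} .$$ *Condition.* Suppose that there are continuous, strictly positive prior probability densities $w_k$ (with respect to Lebesgue measure) on $\Theta_k$ and Bayesian prediction strategies $\bar p^B_k$, that is, prediction strategies with joint densities $\bar p^B_k(x^n)=\int_{\Theta_k}p_\theta(x^n)\,w_k(\theta)\,d\theta$ (as densities, that is,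 up to $\nu^n$-null sets), such that: 1. $\pi(\mathbf s)>0$ whenever $m(\mathbf s)=1$; for some constant $c>0$, $\pi(E_{\mathbf s})\le c\,\pi(\mathbf s)$ for all $\mathbf s\in\mathbb S$; and for all $k\ne k'$, all $n\ge 0$ and all $x^n\in\mathcal X^n$ with $\bar p^B_k(x^n)\neq 0$ and $\bar p^B_{k'}(x^n)\ne 0$, the distributions $\bar P^B_k(X_{n+1}^\infty\mid x^n)$ and $\bar P^B_{k'}(X_{n+1}^\infty\mid x^n)$ are mutually singular. 2. For all $k$ and every compact subset $\Theta'$ of the interior of $\Theta_k$ there is a $K\in\mathbb R$ such that for all $\theta\in\Theta'$, with $P_\theta$-probability $1$, for all $n$: $-\log\bar p_k(X^n)+\log\bar p^B_k(X^n)\le K$ (that is, $\bar p^B_k(X^n)\le e^{K}\,\bar p_k(X^n)$). 3. For all $k\ne k'$, all $n\ge 0$ and all $x^n\in\mathcal X^n$ with $\bar p^B_k(x^n)\neq 0$, the distributions $\bar P^B_k(X_{n+1}^\infty\mid x^n)$ and $\bar P_{k'}(X_{n+1}^\infty\mid x^n)$ are mutually singular. *Conclusion.* Then for every $k^*\in\mathbb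 Z^+$ and for all $\theta^*\in\Theta_{k^*}$ except for a subset of $\Theta_{k^*}$ of Lebesgue measure $0$, $$\pi(K_{n+1}=k^*\mid X^n)\longrightarrow 1\quad(n\to\infty)\qquad\text{with } P_{\theta^*}\text{-probability }1 .$$ -/

import Mathlib

open MeasureTheory ProbabilityTheory Set Filter Topology
open scoped NNReal ENNReal

/-- The dominating measure on the sample space `S ⊆ ℝ^d`: counting measure if `S` is countable,
Lebesgue measure (restricted to `S`) otherwise. -/
noncomputable def referenceMeasure {d : ℕ} (S : Set (EuclideanSpace ℝ (Fin d))) : Measure S :=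
  open Classical in
  if S.Countable then Measure.count else Measure.comap Subtype.val volume

instance referenceMeasure_sigmaFinite {d : ℕ} (S : Set (EuclideanSpace ℝ (Fin d))) :
    SigmaFinite (referenceMeasure S) := by
  unfold referenceMeasure
  split_ifs with h
  · have : Countable S := h.to_subtype
    infer_instance
  · refine ⟨⟨⟨fun n => Subtype.val ⁻¹' spanningSets volume n, fun _ => mem_univ _, fun n => ?_, ?_⟩⟩⟩
    · refine (Measure.comap_apply_le _ _
        (measurable_subtype_coe (measurableSet_spanningSets _ n)).nullMeasurableSet).trans_lt ?_
      exact (measure_mono (image_preimage_subset _ _)).trans_lt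
        (measure_spanningSets_lt_top volume n)
    · rw [← preimage_iUnion, iUnion_spanningSets, preimage_univ]

/-- A prediction strategy for outcomes in `X`: to each past `x^n = (x_1, …, x_n)` it assigns a
probability density `dens n x^n` (with respect to `ν`) for the next outcome `X_{n+1}`. -/
structure PredictionStrategy {X : Type*} [MeasurableSpace X] (ν : Measure X) where
  dens : (n : ℕ) → (Fin n → X) → X → ℝ≥0∞
  measurable_dens : ∀ n, Measurable (fun z : (Fin n → X) × X => dens n z.1 z.2)
  lintegral_dens : ∀ n x, ∫⁻ y, dens n x y ∂ν = 1

namespace PredictionStrategy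

variable {X : Type*} [MeasurableSpace X] {ν : Measure X}

/-- The joint density `p(x^n) = p(x_1) p(x_2 | x_1) ⋯ p(x_n | x^{n-1})`. -/
noncomputable def joint (p : PredictionStrategy ν) (n : ℕ) (x : Fin n → X) : ℝ≥0∞ :=
  ∏ i : Fin n, p.dens i (fun j : Fin i => x ⟨j, j.2.trans i.2⟩) (x i)

/-- The conditional distribution `P(X_{n+1} | x^n)` of the next outcome. -/
noncomputable def next (p : PredictionStrategy ν) (n : ℕ) (x : Fin n → X) : Measure X :=
  ν.withDensity (p.dens n x)

instance (p : PredictionStrategy ν) (n : ℕ) (x : Fin n → X) :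
    IsProbabilityMeasure (p.next n x) :=
  ⟨by rw [next, withDensity_apply _ MeasurableSet.univ, Measure.restrict_univ,
    p.lintegral_dens n x]⟩

/-- The predictions for `X_{n+2}` as a Markov kernel, in the indexing used for
infinite products of kernels (the past `x_1, …, x_{n+1}` is indexed by `{0, …, n}`). -/
noncomputable def kernel [SFinite ν] (p : PredictionStrategy ν) (n : ℕ) :
    Kernel (Π _ : Finset.Iic n, X) X where
  toFun y := p.next (n + 1)
    (fun i => y ⟨i, Finset.mem_Iic.2 (Nat.lt_succ_iff.1 i.2)⟩)
  measurable' := by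
    refine Measure.measurable_of_measurable_coe _ fun s hs => ?_
    simp only [next, withDensity_apply _ hs]
    refine Measurable.lintegral_prod_right' (ν := ν.restrict s)
      (f := fun z : (Π _ : Finset.Iic n, X) × X => p.dens (n + 1)
        (fun i => z.1 ⟨i, Finset.mem_Iic.2 (Nat.lt_succ_iff.1 i.2)⟩) z.2) ?_
    refine (p.measurable_dens (n + 1)).comp (Measurable.prodMk ?_ measurable_snd)
    exact measurable_pi_lambda _ fun i => (measurable_pi_apply _).comp measurable_fst

instance [SFinite ν] (p : PredictionStrategy ν) (n : ℕ) : IsMarkovKernel (p.kernel n) :=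
  ⟨fun _ => inferInstanceAs (IsProbabilityMeasure (p.next (n + 1) _))⟩

/-- The distribution `P(X^∞)` on infinite sequences `X_1, X_2, …` (indexed from `0`)
that is determined by the strategy, by the Ionescu-Tulcea theorem. -/
noncomputable def law [SFinite ν] (p : PredictionStrategy ν) : Measure (ℕ → X) :=
  Kernel.trajMeasure (X := fun _ => X) (p.next 0 Fin.elim0) p.kernel

/-- The strategy `p`, started after the outcomes `x^n` have been observed. -/
def after (p : PredictionStrategy ν) (n : ℕ) (x : Fin n → X) : PredictionStrategy ν where
  dens j y := p.dens (n + j) (Fin.append x y)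
  measurable_dens j := by
    refine (p.measurable_dens (n + j)).comp (Measurable.prodMk ?_ measurable_snd)
    refine measurable_pi_lambda _ fun i => ?_
    change Measurable fun z : (Fin j → X) × X => Fin.append x z.1 i
    induction i using Fin.addCases with
    | left i => simp only [Fin.append_left, measurable_const]
    | right i =>
      simp only [Fin.append_right]
      exact (measurable_pi_apply i).comp measurable_fst
  lintegral_dens j y := p.lintegral_dens (n + j) (Fin.append x y)

/-- The conditional distribution `P(X_{n+1}^∞ | x^n)` of all future outcomes given `x^n`. -/
noncomputable def condLaw [SFinite ν] (p : PredictionStrategy ν) (n : ℕ) (x : Fin n → X) :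
    Measure (ℕ → X) :=
  (p.after n x).law

end PredictionStrategy

/-- The first `n` outcomes `X^n` of the sequence `X^∞`. -/
def initialSegment {X : Type*} (n : ℕ) (ω : ℕ → X) : Fin n → X := fun i => ω i

/-- A parametric model `{p_θ : θ ∈ Θ}` with `Θ ⊆ ℝ^dim`. -/
structure ParametricModel {X : Type*} [MeasurableSpace X] (ν : Measure X) where
  dim : ℕ
  param : Set (EuclideanSpace ℝ (Fin dim))
  measurableSet_param : MeasurableSet param
  strategy : param → PredictionStrategy ν
  measurable_strategy : ∀ n,
    Measurable (fun z : param × (Fin n → X) × X => (strategy z.1).dens n z.2.1 z.2.2)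

namespace ParametricModel

variable {X : Type*} [MeasurableSpace X] {ν : Measure X}

/-- Lebesgue measure on the parameter space `Θ`. -/
noncomputable def lebesgue (M : ParametricModel ν) : Measure M.param :=
  Measure.comap Subtype.val volume

/-- `w` is a continuous, strictly positive prior density on the parameter space `Θ`
(with respect to Lebesgue measure). -/
def IsPositivePrior (M : ParametricModel ν) (w : M.param → ℝ≥0) : Prop :=
  Continuous w ∧ (∀ θ, 0 < w θ) ∧ ∫⁻ θ, (w θ : ℝ≥0∞) ∂M.lebesgue = 1

/-- The Bayesian marginal density `∫_Θ p_θ(x^n) w(θ) dθ`. -/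
noncomputable def bayesMarginal (M : ParametricModel ν) (w : M.param → ℝ≥0) (n : ℕ)
    (x : Fin n → X) : ℝ≥0∞ :=
  ∫⁻ θ, (M.strategy θ).joint n x * w θ ∂M.lebesgue

/-- `p` is a Bayesian prediction strategy for the model `M` and the prior density `w`: its joint
density for `X^n` is the Bayesian marginal density. (Densities are compared up to null sets of the
dominating measure; for counting measure this is equality everywhere.) -/
def IsBayesStrategy (M : ParametricModel ν) (w : M.param → ℝ≥0) (p : PredictionStrategy ν) :
    Prop :=
  ∀ n, p.joint n =ᵐ[Measure.pi fun _ : Fin n => ν] M.bayesMarginal w n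

end ParametricModel

/-- The parameters `s = ((t_1, k_1), …, (t_m, k_m))`, `m ≥ 1`, `0 = t_1 < ⋯ < t_m`, of
the combinator strategies. -/
def SwitchParam : Type :=
  {l : List (ℕ × ℕ+) // l.head?.map Prod.fst = some 0 ∧ l.Pairwise fun a b => a.1 < b.1}

namespace SwitchParam

/-- The number `m(s)` of constituent strategies. -/
def m (s : SwitchParam) : ℕ := s.1.length

/-- `IsExtension s s'` says that `s' ∈ E_s`: `s'` has strictly more entries than `s`,
and its first `m(s)` entries are those of `s`. -/
def IsExtension (s s' : SwitchParam) : Prop := s.m < s'.m ∧ s.1 <+: s'.1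

theorem filter_ne_nil (s : SwitchParam) (n : ℕ) :
    s.1.filter (fun e => decide (e.1 ≤ n)) ≠ [] := by
  obtain ⟨l, hl, -⟩ := s
  cases l with
  | nil => simp at hl
  | cons a l =>
    have h : a.1 = 0 := by simpa using hl
    simp [h]

/-- `K_{n+1}(s)`: the index of the strategy that predicts `X_{n+1}`, that is, the index `k_i` of
the last entry `(t_i, k_i)` of `s` with `t_i ≤ n`. -/
def active (s : SwitchParam) (n : ℕ) : ℕ+ :=
  ((s.1.filter fun e => decide (e.1 ≤ n)).getLast (s.filter_ne_nil n)).2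

end SwitchParam

section Switch

variable {X : Type*} [MeasurableSpace X] {ν : Measure X}

/-- The combinator strategy `q_s` that uses `p_{k_i}` for the predictions given `x^n`
with `t_i ≤ n < t_{i+1}`. -/
def combinator (p : ℕ+ → PredictionStrategy ν) (s : SwitchParam) : PredictionStrategy ν where
  dens n := (p (s.active n)).dens n
  measurable_dens n := (p (s.active n)).measurable_dens n
  lintegral_dens n := (p (s.active n)).lintegral_dens n

/-- The marginal density `p_sw(x^n) = ∑_s q_s(x^n) π(s)` of the switch distribution. -/
noncomputable def switchMarginal (p : ℕ+ → PredictionStrategy ν) (π : PMF SwitchParam) (n : ℕ)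
    (x : Fin n → X) : ℝ≥0∞ :=
  ∑' s, (combinator p s).joint n x * π s

/-- The posterior probability `π(K_{n+1} = k | x^n)`. -/
noncomputable def switchPosterior (p : ℕ+ → PredictionStrategy ν) (π : PMF SwitchParam) (n : ℕ)
    (x : Fin n → X) (k : ℕ+) : ℝ≥0∞ :=
  (∑' s : {s : SwitchParam // s.active n = k}, (combinator p s.1).joint n x * π s.1) /
    switchMarginal p π n x

/-- The conditions on the prior of the switch distribution: it is positive wherever `m(s) = 1`, and
for some constant `c > 0`, `π(E_s) ≤ c π(s)` for all `s`. -/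
def SwitchPriorCondition (π : PMF SwitchParam) : Prop :=
  (∀ s : SwitchParam, s.m = 1 → 0 < π s) ∧
    ∃ c : ℝ≥0, 0 < c ∧ ∀ s : SwitchParam, ∑' s' : {s' // s.IsExtension s'}, π s'.1 ≤ c * π s

/-- The condition relating the predictors `pbar k` to Bayesian strategies `pB k` for the models
`M k`. Conditional distributions of a Bayesian strategy are considered at those
`x^n` where its marginal density does not vanish; elsewhere they are undefined. -/
def BayesComparisonCondition [SFinite ν] (M : ℕ+ → ParametricModel ν)
    (pbar : ℕ+ → PredictionStrategy ν) (π : PMF SwitchParam) : Prop :=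
  ∃ (w : (k : ℕ+) → (M k).param → ℝ≥0) (pB : ℕ+ → PredictionStrategy ν),
    (∀ k, (M k).IsPositivePrior (w k)) ∧
    (∀ k, (M k).IsBayesStrategy (w k) (pB k)) ∧
    SwitchPriorCondition π ∧
    (∀ k k', k ≠ k' → ∀ (n : ℕ) (x : Fin n → X),
      (pB k).joint n x ≠ 0 → (pB k').joint n x ≠ 0 →
        (pB k).condLaw n x ⟂ₘ (pB k').condLaw n x) ∧
    (∀ k, ∀ C : Set (EuclideanSpace ℝ (Fin (M k).dim)), IsCompact C →
      C ⊆ interior (M k).param → ∃ K : ℝ, ∀ θ : (M k).param, (θ : EuclideanSpace ℝ _) ∈ C →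
        ∀ᵐ ω ∂((M k).strategy θ).law, ∀ n,
          -ENNReal.log ((pbar k).joint n (initialSegment n ω))
            + ENNReal.log ((pB k).joint n (initialSegment n ω)) ≤ (K : EReal)) ∧
    (∀ k k', k ≠ k' → ∀ (n : ℕ) (x : Fin n → X),
      (pB k).joint n x ≠ 0 →
        (pB k).condLaw n x ⟂ₘ (pbar k').condLaw n x)

end Switch

/-! Fix `k` and write the posterior of `k` as `G / (G + B)`, where `G` sums over the parameters
active with `k` at time `n` and `B` over the others. The claim is `B / G → 0`.

Upper bound for `B`: the density of `x^n` under a parameter depends only on its entries up to time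
`n`. Grouping parameters by this truncation, the prior condition `π(E_s) ≤ c π(s)` gives `B ≤ (1 +
c) W`, where `W` sums only over parameters whose last index is not `k` (`tsum_active_ne_le`). The
index set of `W` no longer depends on `n`, so `W` is the density of a fixed finite measure. After
its last switch each parameter in `W` predicts like some `pbar k'` with `k' ≠ k`; hence this measure
is singular to the Bayesian law of `pB k` (`mutuallySingular_partialLaw`), and `W / pB k → 0` almost
surely under that law (`tendsto_likelihoodRatio`).

The Bayesian law is a mixture of the model with positive weights, so the same limit holds under the
law of almost every `θ` (`ae_ae`). For `θ` in the interior, `pB k ≤ e^K pbar k` along almost every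
sequence, and the parameter that never leaves `k` gives `G ≥ π(single k) pbar k`. Thus `B / G` is at
most a constant times `W / pB k`. -/

section SequenceSpace

/-! ### Cylinder sets in the space of sequences. -/

variable {X : Type*} [MeasurableSpace X]

@[fun_prop]
theorem measurable_initialSegment (n : ℕ) :
    Measurable (initialSegment n : (ℕ → X) → Fin n → X) :=
  measurable_pi_lambda _ fun _ => measurable_pi_apply _

/-- The sets of sequences that are determined by finitely many outcomes. -/
def initialCylinders (X : Type*) [MeasurableSpace X] : Set (Set (ℕ → X)) :=
  {A | ∃ (n : ℕ) (B : Set (Fin n → X)), MeasurableSet B ∧ initialSegment n ⁻¹' B = A}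

theorem measurable_take {m n : ℕ} (h : m ≤ n) :
    Measurable (fun (x : Fin n → X) (i : Fin m) => x (Fin.castLE h i)) :=
  measurable_pi_lambda _ fun _ => measurable_pi_apply _

theorem isPiSystem_initialCylinders : IsPiSystem (initialCylinders X) := by
  rintro _ ⟨m, B, hB, rfl⟩ _ ⟨n, C, hC, rfl⟩ -
  refine ⟨max m n, (fun x i => x (Fin.castLE (le_max_left m n) i)) ⁻¹' B ∩
    (fun x i => x (Fin.castLE (le_max_right m n) i)) ⁻¹' C,
    (measurable_take _ hB).inter (measurable_take _ hC), rfl⟩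

theorem generateFrom_initialCylinders :
    (MeasurableSpace.pi : MeasurableSpace (ℕ → X)) =
      MeasurableSpace.generateFrom (initialCylinders X) := by
  apply le_antisymm
  · refine iSup_le fun i => ?_
    rintro _ ⟨B, hB, rfl⟩
    exact MeasurableSpace.measurableSet_generateFrom
      ⟨i + 1, (fun x => x (Fin.last i)) ⁻¹' B, measurable_pi_apply _ hB, rfl⟩
  · refine MeasurableSpace.generateFrom_le ?_
    rintro _ ⟨n, B, hB, rfl⟩
    exact measurable_initialSegment n hB

theorem map_initialSegment_of_le {μ μ' : Measure (ℕ → X)} {m n : ℕ} (h : m ≤ n)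
    (hn : μ.map (initialSegment n) = μ'.map (initialSegment n)) :
    μ.map (initialSegment m) = μ'.map (initialSegment m) := by
  have key (ρ : Measure (ℕ → X)) : ρ.map (initialSegment m) =
      (ρ.map (initialSegment n)).map (fun x i => x (Fin.castLE h i)) := by
    rw [Measure.map_map (measurable_take h) (measurable_initialSegment n)]
    rfl
  rw [key, key, hn]

/-- Finite measures on sequences agree if the distributions of the initial segments do. -/
theorem ext_of_map_initialSegment {μ μ' : Measure (ℕ → X)} [IsFiniteMeasure μ]
    (h : ∀ n, μ.map (initialSegment n) = μ'.map (initialSegment n)) : μ = μ' := by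
  refine ext_of_generate_finite _ generateFrom_initialCylinders isPiSystem_initialCylinders ?_ ?_
  · rintro _ ⟨n, B, hB, rfl⟩
    rw [← Measure.map_apply (measurable_initialSegment n) hB, h,
      Measure.map_apply (measurable_initialSegment n) hB]
  · have := congrArg (fun ρ => ρ univ) (h 0)
    simpa [Measure.map_apply (measurable_initialSegment 0) MeasurableSet.univ] using this

theorem measurable_of_map_initialSegment {α : Type*} [MeasurableSpace α]
    {κ : α → Measure (ℕ → X)} [∀ a, IsProbabilityMeasure (κ a)]
    (h : ∀ n, ∀ B : Set (Fin n → X), MeasurableSet B →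
      Measurable fun a => (κ a).map (initialSegment n) B) : Measurable κ := by
  refine Measurable.measure_of_isPiSystem_of_isProbabilityMeasure generateFrom_initialCylinders
    isPiSystem_initialCylinders ?_
  rintro _ ⟨n, B, hB, rfl⟩
  simpa only [Measure.map_apply (measurable_initialSegment n) hB] using h n B hB

end SequenceSpace

/-! ### Joint densities and one-step predictions of a strategy. -/

namespace PredictionStrategy

variable {X : Type*} [MeasurableSpace X] {ν : Measure X}

/-- A family of strategies that depends measurably on its parameter. -/
def MeasurableFamily {α : Type*} [MeasurableSpace α] (p : α → PredictionStrategy ν) : Prop :=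
  ∀ n, Measurable (fun z : α × (Fin n → X) × X => (p z.1).dens n z.2.1 z.2.2)

theorem measurableFamily_const {α : Type*} [MeasurableSpace α] (p : PredictionStrategy ν) :
    MeasurableFamily (fun _ : α => p) :=
  fun n => (p.measurable_dens n).comp measurable_snd

theorem measurable_append (t j : ℕ) :
    Measurable (fun z : (Fin t → X) × (Fin j → X) => (Fin.append z.1 z.2 : Fin (t + j) → X)) := by
  refine measurable_pi_lambda _ fun i => ?_
  change Measurable fun z : (Fin t → X) × (Fin j → X) => Fin.append z.1 z.2 i
  induction i using Fin.addCases with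
  | left i =>
    simp only [Fin.append_left]
    exact (measurable_pi_apply i).comp measurable_fst
  | right i =>
    simp only [Fin.append_right]
    exact (measurable_pi_apply i).comp measurable_snd

theorem measurableFamily_after (p : PredictionStrategy ν) (t : ℕ) :
    MeasurableFamily (p.after t) := by
  intro j
  refine (p.measurable_dens (t + j)).comp
    (Measurable.prodMk ?_ (measurable_snd.comp measurable_snd))
  exact (measurable_append t j).comp
    (measurable_fst.prodMk (measurable_fst.comp measurable_snd))

theorem MeasurableFamily.measurable_joint {α : Type*} [MeasurableSpace α]
    {p : α → PredictionStrategy ν} (hp : MeasurableFamily p) (n : ℕ) :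
    Measurable (fun z : α × (Fin n → X) => (p z.1).joint n z.2) := by
  refine Finset.measurable_prod _ fun i _ => ?_
  have h : Measurable (fun z : α × (Fin n → X) =>
      (z.1, (fun j : Fin i => z.2 ⟨j, j.2.trans i.2⟩), z.2 i)) := by
    refine measurable_fst.prodMk
      (Measurable.prodMk ?_ ((measurable_pi_apply i).comp measurable_snd))
    exact measurable_pi_lambda _ fun j => (measurable_pi_apply _).comp measurable_snd
  exact (hp i).comp h

theorem measurable_joint (p : PredictionStrategy ν) (n : ℕ) : Measurable (p.joint n) :=
  ((measurableFamily_const (α := Unit) p).measurable_joint n).comp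
    (measurable_const (a := ()) |>.prodMk measurable_id)

theorem joint_snoc (p : PredictionStrategy ν) (n : ℕ) (x : Fin n → X) (y : X) :
    p.joint (n + 1) (Fin.snoc x y : Fin (n + 1) → X) = p.joint n x * p.dens n x y := by
  rw [joint, Fin.prod_univ_castSucc]
  congr 1
  · refine Finset.prod_congr rfl fun i _ => ?_
    simp only [Fin.snoc_castSucc, Fin.val_castSucc]
    congr 1
    funext j
    exact Fin.snoc_castSucc (α := fun _ => X) y x ⟨j, j.2.trans i.2⟩
  · simp only [Fin.snoc_last, Fin.val_last]
    congr 1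
    funext j
    exact Fin.snoc_castSucc (α := fun _ => X) y x j

theorem joint_append (p : PredictionStrategy ν) (t j : ℕ) (x : Fin t → X) (y : Fin j → X) :
    p.joint (t + j) (Fin.append x y) = p.joint t x * (p.after t x).joint j y := by
  rw [joint, Fin.prod_univ_add]
  congr 1
  · refine Finset.prod_congr rfl fun i _ => ?_
    simp only [Fin.append_left, Fin.val_castAdd]
    congr 1
    funext l
    exact Fin.append_left x y ⟨l, l.2.trans i.2⟩
  · refine Finset.prod_congr rfl fun i _ => ?_
    simp only [Fin.append_right, Fin.val_natAdd, after]
    congr 1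
    funext l
    induction l using Fin.addCases with
    | left l =>
      simp only [Fin.append_left]
      exact Fin.append_left x y l
    | right l =>
      simp only [Fin.append_right]
      exact Fin.append_right x y ⟨l, l.2.trans i.2⟩

instance [SFinite ν] (p : PredictionStrategy ν) : IsProbabilityMeasure p.law :=
  inferInstanceAs (IsProbabilityMeasure (Kernel.trajMeasure _ _))

instance [SFinite ν] (p : PredictionStrategy ν) (n : ℕ) (x : Fin n → X) :
    IsProbabilityMeasure (p.condLaw n x) :=
  inferInstanceAs (IsProbabilityMeasure (law _))

/-- The predictions for `X_{n+1}` as a kernel. -/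
noncomputable def nextKernel [SFinite ν] (p : PredictionStrategy ν) (n : ℕ) :
    Kernel (Fin n → X) X where
  toFun := p.next n
  measurable' := by
    refine Measure.measurable_of_measurable_coe _ fun s hs => ?_
    simp only [next, withDensity_apply _ hs]
    exact (p.measurable_dens n).lintegral_prod_right' (ν := ν.restrict s)

instance [SFinite ν] (p : PredictionStrategy ν) (n : ℕ) : IsMarkovKernel (p.nextKernel n) :=
  ⟨fun _ => inferInstanceAs (IsProbabilityMeasure (p.next n _))⟩

theorem law_map_zero [SFinite ν] (p : PredictionStrategy ν) :
    p.law.map (fun ω => ω 0) = p.next 0 Fin.elim0 := by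
  set u := MeasurableEquiv.piUnique (fun _ : Finset.Iic 0 => X)
  have h : p.law.map (Preorder.frestrictLe 0) = (p.next 0 Fin.elim0).map u.symm := by
    rw [law, Kernel.trajMeasure, Measure.map_comp _ _ (by fun_prop), Kernel.traj_map_frestrictLe,
      Kernel.partialTraj_self, Measure.id_comp]
  have h2 := congrArg (Measure.map u) h
  rw [Measure.map_map u.measurable (by fun_prop), Measure.map_map u.measurable u.symm.measurable,
    MeasurableEquiv.self_comp_symm, Measure.map_id] at h2
  exact h2

/-- For positive `n` this is the defining property of the Ionescu-Tulcea measure, reindexed from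
`Finset.Iic` to `Fin`. The case `n = 0` is separate because there the next outcome is drawn from the
initial distribution and not from `kernel`. -/
theorem law_map_succ [SFinite ν] (p : PredictionStrategy ν) (n : ℕ) :
    p.law.map (fun ω => (initialSegment n ω, ω n)) =
      p.law.map (initialSegment n) ⊗ₘ p.nextKernel n := by
  ext s hs
  rw [Measure.compProd_apply hs, lintegral_map (Kernel.measurable_kernel_prodMk_left hs)
    (measurable_initialSegment n), Measure.map_apply (by fun_prop) hs]
  cases n with
  | zero =>
    have h0 (ω : ℕ → X) : initialSegment 0 ω = Fin.elim0 := Subsingleton.elim _ _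
    simp only [h0, lintegral_const, measure_univ, mul_one]
    change _ = p.next 0 _ _
    rw [← law_map_zero, Measure.map_apply (by fun_prop) (measurable_prodMk_left hs)]
    rfl
  | succ n =>
    set e : (Π _ : Finset.Iic n, X) → Fin (n + 1) → X :=
      fun y i => y ⟨i, Finset.mem_Iic.2 (Nat.lt_succ_iff.1 i.2)⟩ with he
    have hem : Measurable e := measurable_pi_lambda _ fun _ => measurable_pi_apply _
    have h := Kernel.map_frestrictLe_trajMeasure_compProd_eq_map_trajMeasure
      (X := fun _ => X) (μ₀ := p.next 0 Fin.elim0) (κ := p.kernel) (a := n)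
    change p.law.map _ ⊗ₘ _ = p.law.map _ at h
    have hs' : MeasurableSet (Prod.map e id ⁻¹' s) := (hem.prodMap measurable_id) hs
    have h2 := congrArg (fun ρ => ρ (Prod.map e id ⁻¹' s)) h
    rw [Measure.compProd_apply hs', lintegral_map (Kernel.measurable_kernel_prodMk_left hs')
      (by fun_prop), Measure.map_apply (by fun_prop) hs'] at h2
    exact h2.symm

/-! ### Densities of initial segments and disintegration along the past. -/

section CylinderFormula

variable [SigmaFinite ν]

theorem measurable_snoc (n : ℕ) :
    Measurable (fun z : (Fin n → X) × X => (Fin.snoc z.1 z.2 : Fin (n + 1) → X)) := by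
  refine measurable_pi_lambda _ fun i => ?_
  induction i using Fin.lastCases with
  | last =>
    simp only [Fin.snoc_last]
    exact measurable_snd
  | cast i =>
    simp only [Fin.snoc_castSucc]
    exact (measurable_pi_apply i).comp measurable_fst

theorem measurePreserving_snoc (n : ℕ) :
    MeasurePreserving (fun z : (Fin n → X) × X => (Fin.snoc z.1 z.2 : Fin (n + 1) → X))
      ((Measure.pi fun _ => ν).prod ν) (Measure.pi fun _ => ν) where
  measurable := measurable_snoc n
  map_eq := by
    refine (Measure.pi_eq fun s hs => ?_).symm
    have h : (fun z : (Fin n → X) × X => (Fin.snoc z.1 z.2 : Fin (n + 1) → X)) ⁻¹' univ.pi s =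
        (univ.pi fun i => s (Fin.castSucc i)) ×ˢ s (Fin.last n) := by
      ext z
      simp [Fin.forall_fin_succ']
    rw [Measure.map_apply (measurable_snoc n) (MeasurableSet.univ_pi hs), h, Measure.prod_prod,
      Measure.pi_pi, Fin.prod_univ_castSucc]

theorem measurePreserving_append (t j : ℕ) :
    MeasurePreserving
      (fun z : (Fin t → X) × (Fin j → X) => (Fin.append z.1 z.2 : Fin (t + j) → X))
      ((Measure.pi fun _ => ν).prod (Measure.pi fun _ => ν)) (Measure.pi fun _ => ν) where
  measurable := measurable_append t j
  map_eq := by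
    refine (Measure.pi_eq fun s hs => ?_).symm
    have h : (fun z : (Fin t → X) × (Fin j → X) => (Fin.append z.1 z.2 : Fin (t + j) → X)) ⁻¹'
        univ.pi s = (univ.pi fun i => s (Fin.castAdd j i)) ×ˢ
          (univ.pi fun i => s (Fin.natAdd t i)) := by
      ext z
      simp only [mem_preimage, mem_univ_pi, mem_prod]
      refine ⟨fun h => ⟨fun i => by simpa using h (Fin.castAdd j i),
        fun i => by simpa using h (Fin.natAdd t i)⟩, fun h i => ?_⟩
      induction i using Fin.addCases with
      | left i => simpa using h.1 i
      | right i => simpa using h.2 i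
    rw [Measure.map_apply (measurable_append t j) (MeasurableSet.univ_pi hs), h,
      Measure.prod_prod, Measure.pi_pi, Measure.pi_pi, Fin.prod_univ_add]

/-- The chain rule for densities, transported along a gluing map `e`. It serves twice: with
`Fin.snoc` to add one outcome, and with `Fin.append` to add a block. -/
theorem map_compProd_withDensity {α β γ : Type*} [MeasurableSpace α] [MeasurableSpace β]
    [MeasurableSpace γ] {μ : Measure α} {τ : Measure β} {ρ : Measure γ} [SFinite μ] [SFinite τ]
    {e : α × β → γ} (he : MeasurePreserving e (μ.prod τ) ρ) {f : α → ℝ≥0∞} {g : α → β → ℝ≥0∞}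
    {h : γ → ℝ≥0∞} (hf : Measurable f) (hg : Measurable fun z : α × β => g z.1 z.2)
    (hh : Measurable h) (heq : ∀ a b, h (e (a, b)) = f a * g a b) (κ : Kernel α β)
    [IsSFiniteKernel κ] (hκ : ∀ a, κ a = τ.withDensity (g a)) :
    (μ.withDensity f ⊗ₘ κ).map e = ρ.withDensity h := by
  ext B hB
  have hB' := he.measurable hB
  have hm := hh.indicator hB
  rw [Measure.map_apply he.measurable hB, Measure.compProd_apply hB', withDensity_apply _ hB,
    ← lintegral_indicator hB, ← he.lintegral_comp hm,
    lintegral_prod (fun z => B.indicator h (e z)) (hm.comp he.measurable).aemeasurable,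
    lintegral_withDensity_eq_lintegral_mul _ hf (Kernel.measurable_kernel_prodMk_left hB')]
  refine lintegral_congr fun x => ?_
  have hBx := measurable_prodMk_left (x := x) hB'
  simp only [Pi.mul_apply]
  have hgx : Measurable (g x) := hg.comp measurable_prodMk_left
  rw [hκ, withDensity_apply _ hBx, ← lintegral_indicator hBx,
    ← lintegral_const_mul _ (hgx.indicator hBx)]
  refine lintegral_congr fun y => ?_
  by_cases hy : e (x, y) ∈ B
  · simp [indicator, hy, heq]
  · simp [indicator, hy]

/-- The bridge between laws on sequences, where singularity lives, and joint densities, in which the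
posterior is written. -/
theorem law_map_initialSegment (p : PredictionStrategy ν) (n : ℕ) :
    p.law.map (initialSegment n) = (Measure.pi fun _ : Fin n => ν).withDensity (p.joint n) := by
  induction n with
  | zero =>
    have h0 (ω : ℕ → X) : initialSegment 0 ω = Fin.elim0 := Subsingleton.elim _ _
    have h1 : p.joint 0 = fun _ => 1 := by
      funext x
      simp [joint]
    have h2 : (initialSegment 0 : (ℕ → X) → Fin 0 → X) = fun _ => Fin.elim0 := funext h0
    rw [h1, h2, Measure.map_const, measure_univ, one_smul, ← Pi.one_def, withDensity_one,
      Measure.pi_of_empty _ Fin.elim0]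
  | succ n ih =>
    have h1 : (initialSegment (n + 1) : (ℕ → X) → Fin (n + 1) → X) =
        (fun z : (Fin n → X) × X => (Fin.snoc z.1 z.2 : Fin (n + 1) → X)) ∘
          fun ω => (initialSegment n ω, ω n) := by
      funext ω i
      induction i using Fin.lastCases with
      | last => simp [initialSegment]
      | cast i => simp [initialSegment]
    rw [h1, ← Measure.map_map (measurable_snoc n) (by fun_prop), law_map_succ, ih]
    exact map_compProd_withDensity (measurePreserving_snoc n) (p.measurable_joint n)
      (p.measurable_dens n) (p.measurable_joint (n + 1)) (p.joint_snoc n) _ fun _ => rfl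

theorem MeasurableFamily.measurable_law {α : Type*} [MeasurableSpace α]
    {p : α → PredictionStrategy ν} (hp : MeasurableFamily p) : Measurable fun a => (p a).law := by
  refine measurable_of_map_initialSegment fun n B hB => ?_
  simp only [law_map_initialSegment, withDensity_apply _ hB]
  exact (hp.measurable_joint n).lintegral_prod_right' (ν := (Measure.pi fun _ => ν).restrict B)

/-- The conditional distributions of all future outcomes as a kernel. -/
noncomputable def condKernel (p : PredictionStrategy ν) (t : ℕ) : Kernel (Fin t → X) (ℕ → X) where
  toFun := p.condLaw t
  measurable' := (p.measurableFamily_after t).measurable_law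

instance (p : PredictionStrategy ν) (t : ℕ) : IsMarkovKernel (p.condKernel t) :=
  ⟨fun x => inferInstanceAs (IsProbabilityMeasure (p.condLaw t x))⟩

/-- The sequence with first outcomes `x` followed by the sequence `ω`. -/
def prepend {Y : Type*} (t : ℕ) (z : (Fin t → Y) × (ℕ → Y)) (i : ℕ) : Y :=
  if h : i < t then z.1 ⟨i, h⟩ else z.2 (i - t)

theorem measurable_prepend (t : ℕ) :
    Measurable (prepend t : (Fin t → X) × (ℕ → X) → ℕ → X) := by
  refine measurable_pi_lambda _ fun i => ?_
  by_cases h : i < t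
  · simp only [prepend, h, dite_true]
    exact (measurable_pi_apply _).comp measurable_fst
  · simp only [prepend, h, dite_false]
    exact (measurable_pi_apply _).comp measurable_snd

theorem initialSegment_prepend {Y : Type*} (t j : ℕ) (z : (Fin t → Y) × (ℕ → Y)) :
    initialSegment (t + j) (prepend t z) = Fin.append z.1 (initialSegment j z.2) := by
  funext i
  induction i using Fin.addCases with
  | left i => simp [initialSegment, prepend]
  | right i => simp [initialSegment, prepend]

/-- The disintegration of the distribution of the sequence along its first `t` outcomes. -/
theorem law_eq_map_prepend (p : PredictionStrategy ν) (t : ℕ) :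
    p.law = (p.law.map (initialSegment t) ⊗ₘ p.condKernel t).map (prepend t) := by
  refine ext_of_map_initialSegment fun j =>
    map_initialSegment_of_le (Nat.le_add_left j t) ?_
  have h : (initialSegment (t + j) ∘ prepend t : (Fin t → X) × (ℕ → X) → _) =
      (fun z : (Fin t → X) × (Fin j → X) => (Fin.append z.1 z.2 : Fin (t + j) → X)) ∘
        Prod.map id (initialSegment j) := funext fun z => initialSegment_prepend t j z
  rw [Measure.map_map (by fun_prop) (measurable_prepend t), h,
    ← Measure.map_map (measurable_append t j) (by fun_prop),
    ← Measure.compProd_map (measurable_initialSegment j), law_map_initialSegment,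
    law_map_initialSegment]
  refine (map_compProd_withDensity (measurePreserving_append t j) (p.measurable_joint t)
    ((p.measurableFamily_after t).measurable_joint j) (p.measurable_joint (t + j))
    (p.joint_append t j) _ fun x => ?_).symm
  rw [Kernel.map_apply _ (measurable_initialSegment j)]
  exact (p.after t x).law_map_initialSegment j

theorem mutuallySingular_map {α β : Type*} [MeasurableSpace α] [MeasurableSpace β]
    {μ μ' : Measure α} {e : α → β} (he : Measurable e) (h : μ.map e ⟂ₘ μ'.map e) : μ ⟂ₘ μ' := by
  obtain ⟨s, hs, h1, h2⟩ := h
  rw [Measure.map_apply he hs] at h1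
  rw [Measure.map_apply he hs.compl] at h2
  exact ⟨e ⁻¹' s, he hs, h1, h2⟩

/-- Two strategies induce mutually singular distributions if their conditional distributions
after `t` outcomes are mutually singular. -/
theorem mutuallySingular_law [StandardBorelSpace X]
    (p q : PredictionStrategy ν) (t : ℕ)
    (h : ∀ x, p.joint t x ≠ 0 → p.condLaw t x ⟂ₘ q.condLaw t x) : p.law ⟂ₘ q.law := by
  have hsplit : Measurable fun ω : ℕ → X => (initialSegment t ω, fun i => ω (t + i)) :=
    (measurable_initialSegment t).prodMk (measurable_pi_lambda _ fun _ => measurable_pi_apply _)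
  have hinv : (fun ω : ℕ → X => (initialSegment t ω, fun i => ω (t + i))) ∘ prepend t = id := by
    funext z
    refine Prod.ext (funext fun i => ?_) (funext fun i => ?_)
    · simp [initialSegment, prepend]
    · simp [prepend]
  have key (r : PredictionStrategy ν) :
      r.law.map (fun ω => (initialSegment t ω, fun i => ω (t + i))) =
        r.law.map (initialSegment t) ⊗ₘ r.condKernel t := by
    conv_lhs => rw [r.law_eq_map_prepend t]
    rw [Measure.map_map hsplit (measurable_prepend t), hinv, Measure.map_id]
  refine mutuallySingular_map hsplit ?_
  rw [key, key]
  -- Singularity of the conditional laws for almost every past suffices. The pasts are weighted by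
  -- `p`, so those with `p.joint t x = 0` do not matter.
  refine Measure.MutuallySingular.compProd_of_right _ _ ?_
  rw [law_map_initialSegment, ae_withDensity_iff (p.measurable_joint t)]
  exact Eventually.of_forall h

end CylinderFormula

end PredictionStrategy

/-! ### Likelihood ratios of mutually singular laws. -/

section LikelihoodRatio

variable {X : Type*} [MeasurableSpace X]

/-- The filtration generated by the initial segments of the sequence. -/
def initialFiltration (X : Type*) [MeasurableSpace X] :
    Filtration ℕ (MeasurableSpace.pi : MeasurableSpace (ℕ → X)) where
  seq n := MeasurableSpace.comap (initialSegment n) MeasurableSpace.pi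
  mono' := by
    rintro m n h _ ⟨B, hB, rfl⟩
    exact ⟨(fun x i => x (Fin.castLE h i)) ⁻¹' B, measurable_take h hB, rfl⟩
  le' n := (measurable_initialSegment n).comap_le

theorem iSup_initialFiltration :
    ⨆ n, initialFiltration X n = (MeasurableSpace.pi : MeasurableSpace (ℕ → X)) := by
  refine le_antisymm (iSup_le fun n => (initialFiltration X).le n) ?_
  refine generateFrom_initialCylinders.le.trans (MeasurableSpace.generateFrom_le ?_)
  rintro _ ⟨n, B, hB, rfl⟩
  exact le_iSup (fun n => initialFiltration X n) n _ ⟨B, hB, rfl⟩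

/-- If `μ` and `Q` are mutually singular measures on sequences, with densities `f n` and `g n` for
the initial segments, then the likelihood ratio `g n / f n` tends to `0` almost surely. -/
theorem tendsto_likelihoodRatio {μ Q : Measure (ℕ → X)} [IsFiniteMeasure μ] [IsFiniteMeasure Q]
    (ν : (n : ℕ) → Measure (Fin n → X)) {f g : (n : ℕ) → (Fin n → X) → ℝ≥0∞}
    (hf : ∀ n, Measurable (f n)) (hg : ∀ n, Measurable (g n))
    (hμ : ∀ n, μ.map (initialSegment n) = (ν n).withDensity (f n))
    (hQ : ∀ n, Q.map (initialSegment n) = (ν n).withDensity (g n)) (h : μ ⟂ₘ Q) :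
    ∀ᵐ ω ∂μ,
      Tendsto (fun n => g n (initialSegment n ω) / f n (initialSegment n ω)) atTop (𝓝 0) := by
  -- Both measures are dominated by `ρ`. In place of `g / f`, the proof follows `r = g / (f + g)`,
  -- which is bounded by 1 and is a closed martingale under `ρ`.
  set ρ := μ + Q with hρ
  set r : (n : ℕ) → (Fin n → X) → ℝ≥0∞ := fun n x => g n x / (f n x + g n x) with hr
  have hrm n : Measurable (r n) := (hg n).div ((hf n).add (hg n))
  have hr1 n x : r n x ≤ 1 := ENNReal.div_le_of_le_mul (by simp)
  have hρmap n : ρ.map (initialSegment n) = (ν n).withDensity (f n + g n) := by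
    rw [hρ, Measure.map_add _ _ (measurable_initialSegment n), hμ, hQ, withDensity_add_left (hf n)]
  have hfin n : ∀ᵐ x ∂ν n, f n x ≠ ∞ ∧ g n x ≠ ∞ := by
    have key {f : (Fin n → X) → ℝ≥0∞} {μ : Measure (ℕ → X)} [IsFiniteMeasure μ] (hf : Measurable f)
        (hμ : μ.map (initialSegment n) = (ν n).withDensity f) : ∀ᵐ x ∂ν n, f x ≠ ∞ := by
      refine ae_lt_top hf ?_ |>.mono fun x hx => hx.ne
      rw [← setLIntegral_univ, ← withDensity_apply _ MeasurableSet.univ, ← hμ]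
      exact measure_ne_top _ _
    exact (key (hf n) (hμ n)).and (key (hg n) (hQ n))
  have hμρ : μ ≪ ρ := Measure.absolutelyContinuous_of_le (Measure.le_add_right le_rfl)
  have hQρ : Q ≪ ρ := Measure.absolutelyContinuous_of_le (Measure.le_add_left le_rfl)
  -- the posterior weight of `Q` given the first `n` outcomes is `r n`
  have hcond n : ρ[fun ω => (Q.rnDeriv ρ ω).toReal | initialFiltration X n] =ᵐ[ρ]
      fun ω => (r n (initialSegment n ω)).toReal := by
    refine (ae_eq_condExp_of_forall_setIntegral_eq ((initialFiltration X).le n)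
      Measure.integrable_toReal_rnDeriv (fun s _ _ => ?_) ?_ ?_).symm
    · exact (Integrable.of_bound
        ((hrm n).comp (measurable_initialSegment n)).ennreal_toReal.aestronglyMeasurable 1
        (Eventually.of_forall fun ω => by
          rw [Real.norm_of_nonneg ENNReal.toReal_nonneg]
          exact ENNReal.toReal_le_of_le_ofReal zero_le_one (by simpa using hr1 n _))).integrableOn
    · rintro _ ⟨B, hB, rfl⟩ -
      rw [integral_toReal (f := fun ω => r n (initialSegment n ω))
          ((hrm n).comp (measurable_initialSegment n)).aemeasurable
          (Eventually.of_forall fun ω => (hr1 n _).trans_lt ENNReal.one_lt_top),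
        integral_toReal (Measure.measurable_rnDeriv Q ρ).aemeasurable
          (ae_restrict_of_ae (Measure.rnDeriv_lt_top Q ρ)),
        Measure.setLIntegral_rnDeriv hQρ,
        ← setLIntegral_map hB (hrm n) (measurable_initialSegment n),
        hρmap, setLIntegral_withDensity_eq_setLIntegral_mul _ ((hf n).add (hg n)) (hrm n) hB,
        ← Measure.map_apply (measurable_initialSegment n) hB, hQ, withDensity_apply _ hB]
      congr 1
      refine lintegral_congr_ae (ae_restrict_of_ae ?_)
      filter_upwards [hfin n] with x hx
      simp only [hr, Pi.mul_apply, Pi.add_apply]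
      rcases eq_or_ne (f n x + g n x) 0 with h0 | h0
      · simp [(add_eq_zero.1 h0).2]
      · exact ENNReal.mul_div_cancel h0 (ENNReal.add_ne_top.2 hx)
    · exact ((hrm n).comp (comap_measurable (initialSegment n))).ennreal_toReal.aestronglyMeasurable
  -- Lévy's upward theorem: `r` converges to `dQ/dρ`, which singularity forces to vanish `μ`-almost
  -- everywhere.
  have hlim := tendsto_ae_condExp (μ := ρ) (ℱ := initialFiltration X)
    (fun ω => (Q.rnDeriv ρ ω).toReal)
  have h0 : ∀ᵐ ω ∂μ, Q.rnDeriv ρ ω = 0 := by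
    obtain ⟨s, hs, h1, h2⟩ := h
    rw [← Measure.setLIntegral_rnDeriv hQρ, lintegral_eq_zero_iff
      (Measure.measurable_rnDeriv Q ρ)] at h2
    have h3 := hμρ.ae_le ((ae_restrict_iff' hs.compl).1 h2)
    filter_upwards [h3, measure_eq_zero_iff_ae_notMem.1 h1] with ω h4 h5 using h4 h5
  have hpos n : ∀ᵐ ω ∂μ, f n (initialSegment n ω) ≠ 0 ∧ f n (initialSegment n ω) ≠ ∞ ∧
      g n (initialSegment n ω) ≠ ∞ := by
    refine ae_of_ae_map (measurable_initialSegment n).aemeasurable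
      (p := fun x => f n x ≠ 0 ∧ f n x ≠ ∞ ∧ g n x ≠ ∞) ?_
    rw [hμ, ae_withDensity_iff (hf n)]
    filter_upwards [hfin n] with x hx hx0 using ⟨hx0, hx⟩
  rw [iSup_initialFiltration] at hlim
  filter_upwards [hμρ.ae_le hlim, h0, ae_all_iff.2 hpos, hμρ.ae_le (ae_all_iff.2 hcond)]
    with ω h1 h2 h3 h4
  rw [condExp_of_stronglyMeasurable le_rfl
    (Measure.measurable_rnDeriv Q ρ).ennreal_toReal.stronglyMeasurable
    Measure.integrable_toReal_rnDeriv] at h1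
  simp only [h2, h4, ENNReal.toReal_zero] at h1
  have hft n : g n (initialSegment n ω) / f n (initialSegment n ω) ≠ ∞ :=
    ENNReal.div_ne_top (h3 n).2.2 (h3 n).1
  rw [← ENNReal.tendsto_toReal_iff hft ENNReal.zero_ne_top, ENNReal.toReal_zero]
  -- The original ratio is recovered as `g / f = r / (1 - r)`.
  have h5 := h1.div (tendsto_const_nhds (x := (1 : ℝ)).sub h1) (by norm_num)
  rw [zero_div] at h5
  refine h5.congr fun n => ?_
  obtain ⟨h6, h7, h8⟩ := h3 n
  have h9 := ENNReal.toReal_pos h6 h7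
  have h10 := (ENNReal.toReal_nonneg (a := g n (initialSegment n ω)))
  simp only [hr, Pi.div_apply, ENNReal.toReal_div, ENNReal.toReal_add h7 h8]
  have h11 := (add_pos_of_pos_of_nonneg h9 h10).ne'
  rw [one_sub_div h11, add_sub_cancel_right, div_div_div_cancel_right₀ h11]

end LikelihoodRatio

/-! ### Truncation of switch parameters. -/

namespace SwitchParam

instance : Countable SwitchParam := by
  unfold SwitchParam
  infer_instance

theorem ne_nil (s : SwitchParam) : s.1 ≠ [] := fun h => by
  have := s.2.1
  simp [h] at this

/-- The index of the strategy that is used in the end. -/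
def lastIndex (s : SwitchParam) : ℕ+ := (s.1.getLast s.ne_nil).2

/-- The entries of `s` up to time `n`. -/
def truncate (n : ℕ) (s : SwitchParam) : SwitchParam :=
  ⟨s.1.filter fun e => decide (e.1 ≤ n), by
    obtain ⟨l, hl, -⟩ := s
    cases l with
    | nil => simp at hl
    | cons a l =>
      have h : a.1 = 0 := by simpa using hl
      simp [h], s.2.2.filter _⟩

theorem active_truncate {i n : ℕ} (h : i ≤ n) (s : SwitchParam) :
    (s.truncate n).active i = s.active i := by
  have key : (s.truncate n).1.filter (fun e => decide (e.1 ≤ i)) =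
      s.1.filter fun e => decide (e.1 ≤ i) := by
    simp only [truncate, List.filter_filter]
    refine List.filter_congr fun e _ => ?_
    simp only [← Bool.decide_and, decide_eq_decide]
    omega
  simp only [active, key]

theorem exists_active_eq_lastIndex (s : SwitchParam) :
    ∃ t, ∀ n, t ≤ n → s.active n = s.lastIndex := by
  -- Any upper bound for the switching times would do; their sum is one.
  refine ⟨(s.1.map Prod.fst).sum, fun n hn => ?_⟩
  have key : s.1.filter (fun e => decide (e.1 ≤ n)) = s.1 := by
    refine List.filter_eq_self.2 fun e he => ?_
    simpa using (List.le_sum_of_mem (List.mem_map_of_mem (f := Prod.fst) he)).trans hn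
  simp only [active, key, lastIndex]

/-- Since the times increase, filtering by `e.1 ≤ n` keeps a prefix. This places each fibre of
`truncate n` over `b` inside `{b} ∪ E_b`, where the prior condition applies. -/
theorem truncate_eq_or_isExtension (n : ℕ) (s : SwitchParam) :
    s = s.truncate n ∨ (s.truncate n).IsExtension s := by
  have hpre : (s.truncate n).1 <+: s.1 := by
    have key : ∀ l : List (ℕ × ℕ+), (l.Pairwise fun a b => a.1 < b.1) →
        l.filter (fun e => decide (e.1 ≤ n)) <+: l := by
      intro l hl
      induction l with
      | nil => simp
      | cons a l ih =>
        rw [List.pairwise_cons] at hl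
        by_cases ha : a.1 ≤ n
        · simpa [ha] using ih hl.2
        · have : l.filter (fun e => decide (e.1 ≤ n)) = [] := by
            simp only [List.filter_eq_nil_iff, decide_eq_true_eq, not_le]
            exact fun e he => (not_le.1 ha).trans (hl.1 e he)
          simp [ha, this]
    exact key s.1 s.2.2
  rcases hpre.length_le.eq_or_lt with h | h
  · exact Or.inl (Subtype.ext (hpre.eq_of_length h).symm)
  · exact Or.inr ⟨h, hpre⟩

/-- The prior mass of all parameters with the same entries up to time `n`. -/
theorem tsum_truncate_le {π : PMF SwitchParam} {c : ℝ≥0}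
    (hc : ∀ s : SwitchParam, ∑' s' : {s' // s.IsExtension s'}, π s'.1 ≤ c * π s) (n : ℕ)
    (b : SwitchParam) : ∑' s : {s : SwitchParam // s.truncate n = b}, π s ≤ (1 + c) * π b := by
  calc ∑' s : {s : SwitchParam // s.truncate n = b}, π s
      ≤ ∑' s : ↥({b} ∪ {s | b.IsExtension s}), π s := by
        refine ENNReal.tsum_mono_subtype π fun s (hs : s.truncate n = b) => ?_
        have := s.truncate_eq_or_isExtension n
        rwa [hs] at this
    _ ≤ ∑' s : ({b} : Set SwitchParam), π s + ∑' s : {s | b.IsExtension s}, π s :=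
        ENNReal.tsum_union_le π _ _
    _ ≤ π b + c * π b := by
        rw [tsum_singleton b (f := π)]
        exact add_le_add le_rfl (hc b)
    _ = (1 + c) * π b := by rw [add_mul, one_mul]

end SwitchParam

/-! ### Partial sums of the switch distribution. -/

section SwitchSum

variable {X : Type*} [MeasurableSpace X] {ν : Measure X}

theorem joint_combinator_congr (p : ℕ+ → PredictionStrategy ν) {s s' : SwitchParam} {n : ℕ}
    (h : ∀ i, i < n → s.active i = s'.active i) (x : Fin n → X) :
    (combinator p s).joint n x = (combinator p s').joint n x := by
  refine Finset.prod_congr rfl fun i _ => ?_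
  simp only [combinator, h i i.2]

theorem joint_combinator_const (p : ℕ+ → PredictionStrategy ν) {s : SwitchParam} {k : ℕ+} {n : ℕ}
    (h : ∀ i, i < n → s.active i = k) (x : Fin n → X) :
    (combinator p s).joint n x = (p k).joint n x := by
  refine Finset.prod_congr rfl fun i _ => ?_
  simp only [combinator, h i i.2]

/-- The contribution of the parameters in `U` to the density of the switch distribution. -/
noncomputable def partialMarginal (p : ℕ+ → PredictionStrategy ν) (π : PMF SwitchParam)
    (U : Set SwitchParam) (n : ℕ) (x : Fin n → X) : ℝ≥0∞ :=
  ∑' s : U, (combinator p s.1).joint n x * π s.1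

/-- The contribution of the parameters in `U` to the switch distribution. -/
noncomputable def partialLaw [SFinite ν] (p : ℕ+ → PredictionStrategy ν) (π : PMF SwitchParam)
    (U : Set SwitchParam) : Measure (ℕ → X) :=
  Measure.sum fun s : U => π s.1 • (combinator p s.1).law

instance [SFinite ν] (p : ℕ+ → PredictionStrategy ν) (π : PMF SwitchParam)
    (U : Set SwitchParam) : IsFiniteMeasure (partialLaw p π U) := by
  refine ⟨?_⟩
  rw [partialLaw, Measure.sum_apply _ MeasurableSet.univ]
  simp only [Measure.smul_apply, measure_univ, smul_eq_mul, mul_one]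
  refine (ENNReal.tsum_comp_le_tsum_of_injective Subtype.val_injective π).trans_lt ?_
  rw [π.tsum_coe]
  exact ENNReal.one_lt_top

theorem measurable_partialMarginal (p : ℕ+ → PredictionStrategy ν) (π : PMF SwitchParam)
    (U : Set SwitchParam) (n : ℕ) : Measurable (partialMarginal p π U n) :=
  Measurable.tsum fun _ => (PredictionStrategy.measurable_joint _ n).mul_const _

theorem partialLaw_map_initialSegment [SigmaFinite ν] (p : ℕ+ → PredictionStrategy ν)
    (π : PMF SwitchParam) (U : Set SwitchParam) (n : ℕ) :
    (partialLaw p π U).map (initialSegment n) =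
      (Measure.pi fun _ : Fin n => ν).withDensity (partialMarginal p π U n) := by
  ext B hB
  rw [Measure.map_apply (by fun_prop) hB, partialLaw,
    Measure.sum_apply _ (measurable_initialSegment n hB), withDensity_apply _ hB]
  simp only [partialMarginal]
  rw [lintegral_tsum fun s =>
    ((PredictionStrategy.measurable_joint _ n).mul_const _).aemeasurable]
  refine tsum_congr fun s => ?_
  rw [lintegral_mul_const _ (PredictionStrategy.measurable_joint _ n), ← withDensity_apply _ hB,
    ← PredictionStrategy.law_map_initialSegment, Measure.map_apply (by fun_prop) hB,
    Measure.smul_apply, smul_eq_mul, mul_comm]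

/-- Trades an index set that changes with `n` for a fixed one: each parameter is replaced by its
truncation, which has the same density at `x^n`, and the mass of a fibre is at most `1 + c` times
that of the truncation. -/
theorem tsum_active_ne_le (p : ℕ+ → PredictionStrategy ν) {π : PMF SwitchParam} {c : ℝ≥0}
    (hc : ∀ s : SwitchParam, ∑' s' : {s' // s.IsExtension s'}, π s'.1 ≤ c * π s) (k : ℕ+) (n : ℕ)
    (x : Fin n → X) :
    ∑' s : {s : SwitchParam // s.active n ≠ k}, (combinator p s.1).joint n x * π s.1 ≤
      (1 + c) * partialMarginal p π {s | s.lastIndex ≠ k} n x := by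
  -- The last index of `s.truncate n` is by definition `s.active n`. An entry with time exactly `n`
  -- is kept: it determines `K_{n+1}`, although it does not affect the density of `x^n`.
  let φ : {s : SwitchParam // s.active n ≠ k} → {s : SwitchParam // s.lastIndex ≠ k} :=
    fun s => ⟨s.1.truncate n, s.2⟩
  rw [← (Equiv.sigmaFiberEquiv φ).tsum_eq, ENNReal.tsum_sigma', partialMarginal,
    ← ENNReal.tsum_mul_left]
  refine ENNReal.tsum_le_tsum fun b => ?_
  have h1 (s : {s // φ s = b}) :
      (combinator p s.1.1).joint n x = (combinator p b.1).joint n x := by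
    have hs : s.1.1.truncate n = b.1 := congrArg Subtype.val s.2
    rw [← hs]
    exact joint_combinator_congr p (fun i hi => (SwitchParam.active_truncate hi.le _).symm) x
  simp only [Equiv.sigmaFiberEquiv_apply, h1]
  rw [ENNReal.tsum_mul_left, mul_left_comm]
  gcongr
  let e : {s // φ s = b} → {s : SwitchParam // s.truncate n = b.1} :=
    fun s => ⟨s.1.1, congrArg Subtype.val s.2⟩
  have he : Function.Injective e := fun s s' h => by
    have h' : s.1.1 = s'.1.1 := Subtype.mk.inj h
    exact Subtype.ext (Subtype.ext h')
  exact (ENNReal.tsum_comp_le_tsum_of_injective he fun s => π s.1).trans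
    (SwitchParam.tsum_truncate_le hc n b.1)

theorem switchMarginal_eq_add (p : ℕ+ → PredictionStrategy ν) (π : PMF SwitchParam) (k : ℕ+)
    (n : ℕ) (x : Fin n → X) :
    switchMarginal p π n x =
      ∑' s : {s : SwitchParam // s.active n = k}, (combinator p s.1).joint n x * π s.1 +
        ∑' s : {s : SwitchParam // s.active n ≠ k}, (combinator p s.1).joint n x * π s.1 :=
  (ENNReal.summable.tsum_add_tsum_compl (s := {s : SwitchParam | s.active n = k})
    (f := fun s => (combinator p s).joint n x * π s) ENNReal.summable).symm

/-- The parameter that uses strategy `k` forever. -/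
def SwitchParam.single (k : ℕ+) : SwitchParam := ⟨[(0, k)], by simp, by simp⟩

theorem SwitchParam.active_single (k : ℕ+) (n : ℕ) : (single k).active n = k := by
  simp [active, single]

theorem le_tsum_active_eq (p : ℕ+ → PredictionStrategy ν) (π : PMF SwitchParam) (k : ℕ+)
    (n : ℕ) (x : Fin n → X) :
    (p k).joint n x * π (SwitchParam.single k) ≤
      ∑' s : {s : SwitchParam // s.active n = k}, (combinator p s.1).joint n x * π s.1 := by
  refine le_trans (le_of_eq ?_) (ENNReal.le_tsum
    (⟨SwitchParam.single k, SwitchParam.active_single k n⟩ : {s : SwitchParam // s.active n = k}))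
  rw [joint_combinator_const p fun i _ => SwitchParam.active_single k i]

end SwitchSum

/-! ### Singularity, mixtures over the parameter, and consistency. -/

section Consistency

variable {X : Type*} [MeasurableSpace X] {ν : Measure X}

/-- Only the strategy used after the last switch matters: conditionally on the outcomes up to then,
the combinator is `pbar s.lastIndex`. -/
theorem mutuallySingular_combinator [StandardBorelSpace X] [SigmaFinite ν]
    {p : PredictionStrategy ν} {pbar : ℕ+ → PredictionStrategy ν} {k : ℕ+}
    (h : ∀ k', k ≠ k' → ∀ (n : ℕ) (x : Fin n → X), p.joint n x ≠ 0 →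
      p.condLaw n x ⟂ₘ (pbar k').condLaw n x)
    {s : SwitchParam} (hs : s.lastIndex ≠ k) : p.law ⟂ₘ (combinator pbar s).law := by
  obtain ⟨t, ht⟩ := s.exists_active_eq_lastIndex
  refine p.mutuallySingular_law _ t fun x hx => ?_
  have key : (combinator pbar s).after t x = (pbar s.lastIndex).after t x := by
    have hdens : ((combinator pbar s).after t x).dens = ((pbar s.lastIndex).after t x).dens := by
      funext j
      simp only [PredictionStrategy.after, combinator, ht _ (Nat.le_add_right t j)]
    generalize (combinator pbar s).after t x = q at *
    generalize (pbar s.lastIndex).after t x = q' at *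
    cases q
    cases q'
    cases hdens
    rfl
  rw [PredictionStrategy.condLaw, PredictionStrategy.condLaw, key]
  exact h _ hs.symm t x hx

theorem mutuallySingular_partialLaw [StandardBorelSpace X] [SigmaFinite ν]
    {p : PredictionStrategy ν} {pbar : ℕ+ → PredictionStrategy ν} {k : ℕ+} (π : PMF SwitchParam)
    (h : ∀ k', k ≠ k' → ∀ (n : ℕ) (x : Fin n → X), p.joint n x ≠ 0 →
      p.condLaw n x ⟂ₘ (pbar k').condLaw n x) :
    p.law ⟂ₘ partialLaw pbar π {s | s.lastIndex ≠ k} :=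
  Measure.MutuallySingular.sum_right.2 fun s => Measure.MutuallySingular.mono_ac
    (mutuallySingular_combinator h s.2) .rfl Measure.smul_absolutelyContinuous

instance (M : ParametricModel ν) : SigmaFinite M.lebesgue := by
  refine SigmaFinite.of_map _ measurable_subtype_coe.aemeasurable (?_ : SigmaFinite _)
  rw [ParametricModel.lebesgue, map_comap_subtype_coe M.measurableSet_param]
  infer_instance

/-- The Bayesian distribution is the mixture of the distributions in the model. -/
theorem ParametricModel.IsBayesStrategy.law_eq_bind [SigmaFinite ν] {M : ParametricModel ν}
    {w : M.param → ℝ≥0} (hw : Continuous w) {p : PredictionStrategy ν}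
    (hp : M.IsBayesStrategy w p) :
    p.law = (M.lebesgue.withDensity fun θ => w θ).bind fun θ => (M.strategy θ).law := by
  have hfam : PredictionStrategy.MeasurableFamily M.strategy := M.measurable_strategy
  have hwm : Measurable fun θ => (w θ : ℝ≥0∞) := hw.measurable.coe_nnreal_ennreal
  refine ext_of_map_initialSegment fun n => ?_
  ext B hB
  have hB' := measurable_initialSegment n hB
  have hJ := hfam.measurable_joint n
  rw [PredictionStrategy.law_map_initialSegment, withDensity_apply _ hB,
    Measure.map_apply (by fun_prop) hB, Measure.bind_apply hB' hfam.measurable_law.aemeasurable,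
    lintegral_withDensity_eq_lintegral_mul (g := fun θ => (M.strategy θ).law _) _ hwm
      ((Measure.measurable_coe hB').comp hfam.measurable_law),
    lintegral_congr_ae (ae_restrict_of_ae (hp n))]
  simp only [ParametricModel.bayesMarginal]
  rw [lintegral_lintegral_swap
    ((hJ.comp measurable_swap).mul (hwm.comp measurable_snd)).aemeasurable]
  refine lintegral_congr fun θ => ?_
  rw [lintegral_mul_const _ (PredictionStrategy.measurable_joint _ n), ← withDensity_apply _ hB,
    ← PredictionStrategy.law_map_initialSegment, Measure.map_apply (by fun_prop) hB, mul_comm]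
  rfl

/-- A null event of a mixture is null for almost every component. Positivity of `w` turns "almost
every" for the prior into "almost every" for Lebesgue measure. -/
theorem ParametricModel.IsBayesStrategy.ae_ae [SigmaFinite ν] {M : ParametricModel ν}
    {w : M.param → ℝ≥0} (hw : M.IsPositivePrior w) {p : PredictionStrategy ν}
    (hp : M.IsBayesStrategy w p) {P : (ℕ → X) → Prop} (h : ∀ᵐ ω ∂p.law, P ω) :
    ∀ᵐ θ ∂M.lebesgue, ∀ᵐ ω ∂(M.strategy θ).law, P ω := by
  have hfam : PredictionStrategy.MeasurableFamily M.strategy := M.measurable_strategy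
  have hwm : Measurable fun θ => (w θ : ℝ≥0∞) := hw.1.measurable.coe_nnreal_ennreal
  rw [hp.law_eq_bind hw.1] at h
  have h2 := Measure.ae_ae_of_ae_bind hfam.measurable_law.aemeasurable h
  rw [ae_withDensity_iff hwm] at h2
  filter_upwards [h2] with θ hθ
  exact hθ (by simpa using (hw.2.1 θ).ne')

theorem ENNReal.le_mul_of_neg_log_add_log_le {a b : ℝ≥0∞} (ha : a ≠ ∞) (hb : b ≠ 0) {K : ℝ}
    (h : -ENNReal.log a + ENNReal.log b ≤ (K : EReal)) : b ≤ ENNReal.ofReal (Real.exp K) * a := by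
  rw [← ENNReal.log_le_log_iff, ENNReal.log_mul_add,
    ENNReal.log_ofReal_of_pos (Real.exp_pos K), Real.log_exp]
  have hb' : ENNReal.log b ≠ ⊥ := by simpa using hb
  have ha' : ENNReal.log a ≠ ⊤ := by simpa using ha
  generalize ENNReal.log b = y at *
  generalize ENNReal.log a = z at *
  induction z with
  | top => exact absurd rfl ha'
  | bot =>
    rw [EReal.neg_bot, EReal.top_add_of_ne_bot hb', top_le_iff] at h
    exact absurd h (EReal.coe_ne_top K)
  | coe z =>
    induction y with
    | bot => exact bot_le
    | top => simp [← EReal.coe_neg] at h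
    | coe y =>
      norm_cast at h ⊢
      linarith

/-- The complementary share satisfies `B / (G + B) ≤ (c / a) (W / f)`, which tends to 0. -/
theorem tendsto_div_add_one {G B W f : ℕ → ℝ≥0∞} {c a : ℝ≥0∞} (hc : c ≠ ∞) (ha : a ≠ 0)
    (ha' : a ≠ ∞) (hfin : ∀ n, G n + B n ≠ ∞) (hB : ∀ n, B n ≤ c * W n) (hG : ∀ n, a * f n ≤ G n)
    (hf : ∀ n, f n ≠ 0) (h : Tendsto (fun n => W n / f n) atTop (𝓝 0)) :
    Tendsto (fun n => G n / (G n + B n)) atTop (𝓝 1) := by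
  have hC : c * a⁻¹ ≠ ∞ := ENNReal.mul_ne_top hc (ENNReal.inv_ne_top.2 ha)
  have h1 : Tendsto (fun n => 1 - c * a⁻¹ * (W n / f n)) atTop (𝓝 1) := by
    have := ENNReal.Tendsto.sub (tendsto_const_nhds (x := (1 : ℝ≥0∞)))
      (ENNReal.Tendsto.const_mul h (Or.inr hC)) (Or.inl ENNReal.one_ne_top)
    simpa using this
  refine tendsto_of_tendsto_of_tendsto_of_le_of_le h1 tendsto_const_nhds (fun n => ?_) fun n => ?_
  · have hG0 : G n + B n ≠ 0 := fun h0 =>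
      mul_ne_zero ha (hf n) (le_antisymm ((hG n).trans_eq (add_eq_zero.1 h0).1) zero_le)
    simp only
    rw [tsub_le_iff_right, ← ENNReal.div_self hG0 (hfin n), ENNReal.add_div]
    gcongr
    calc B n / (G n + B n) ≤ c * W n / (a * f n) := by
          gcongr
          · exact hB n
          · exact (hG n).trans le_self_add
      _ = c * a⁻¹ * (W n / f n) := by
          rw [div_eq_mul_inv, ENNReal.mul_inv (Or.inl ha) (Or.inl ha'), div_eq_mul_inv]
          ring
  · exact ENNReal.div_le_of_le_mul (by simp)

/-- Consistency of the switch distribution, for outcomes in a standard Borel space. -/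
theorem switchPosterior_tendsto_one [StandardBorelSpace X] [SigmaFinite ν]
    (M : ℕ+ → ParametricModel ν)
    (hM : ∀ k, volume ((M k).param \ interior (M k).param) = 0)
    (pbar : ℕ+ → PredictionStrategy ν) (π : PMF SwitchParam)
    (hcond : BayesComparisonCondition M pbar π) (k : ℕ+) :
    ∀ᵐ θ ∂(M k).lebesgue, ∀ᵐ ω ∂((M k).strategy θ).law,
      Tendsto (fun n => switchPosterior pbar π n (initialSegment n ω) k) atTop (𝓝 1) := by
  obtain ⟨w, pB, hw, hB, ⟨hπ, c, -, hc⟩, -, hK, hsing⟩ := hcond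
  have hint : ∀ᵐ θ : (M k).param ∂(M k).lebesgue,
      (θ : EuclideanSpace ℝ (Fin (M k).dim)) ∈ interior (M k).param := by
    refine ae_of_ae_map (μ := (M k).lebesgue) (f := Subtype.val)
      measurable_subtype_coe.aemeasurable
      (p := fun x => x ∈ interior (M k).param) ?_
    rw [ParametricModel.lebesgue, map_comap_subtype_coe (M k).measurableSet_param,
      ae_restrict_iff' (M k).measurableSet_param]
    have hMk := measure_eq_zero_iff_ae_notMem.1 (hM k)
    filter_upwards [hMk] with x hx hxM
    by_contra hxi
    exact hx ⟨hxM, hxi⟩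
  have hratio := tendsto_likelihoodRatio (fun n => Measure.pi fun _ : Fin n => ν)
    (fun n => (pB k).measurable_joint n)
    (measurable_partialMarginal pbar π {s | s.lastIndex ≠ k})
    (pB k).law_map_initialSegment (partialLaw_map_initialSegment pbar π _)
    (mutuallySingular_partialLaw π (hsing k))
  have hfin : ∀ᵐ ω ∂(pB k).law, ∀ n, (pB k).joint n (initialSegment n ω) ≠ 0 ∧
      switchMarginal pbar π n (initialSegment n ω) ≠ ∞ := by
    refine ae_all_iff.2 fun n => ae_of_ae_map (measurable_initialSegment n).aemeasurable
      (p := fun x => (pB k).joint n x ≠ 0 ∧ switchMarginal pbar π n x ≠ ∞) ?_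
    have h1 : switchMarginal pbar π n = partialMarginal pbar π univ n := funext fun x =>
      (tsum_univ fun s => (combinator pbar s).joint n x * π s).symm
    have h2 : ∀ᵐ x ∂(Measure.pi fun _ : Fin n => ν), switchMarginal pbar π n x < ∞ := by
      rw [h1]
      refine ae_lt_top (measurable_partialMarginal pbar π univ n) ?_
      rw [← setLIntegral_univ, ← withDensity_apply _ MeasurableSet.univ,
        ← partialLaw_map_initialSegment]
      exact measure_ne_top _ _
    rw [PredictionStrategy.law_map_initialSegment, ae_withDensity_iff ((pB k).measurable_joint n)]
    filter_upwards [h2] with x hx h0 using ⟨h0, hx.ne⟩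
  filter_upwards [(hB k).ae_ae (hw k) (hratio.and hfin), hint] with θ hθ hθint
  -- `θ` is already fixed, so `K` may depend on it and a one-point compact set is enough.
  obtain ⟨K, hKθ⟩ := hK k {(θ : EuclideanSpace ℝ _)} isCompact_singleton
    (singleton_subset_iff.2 hθint)
  have h0 := hπ (SwitchParam.single k) rfl
  have hE : ENNReal.ofReal (Real.exp K) ≠ 0 := by simpa using Real.exp_pos K
  filter_upwards [hθ, hKθ θ rfl] with ω ⟨h1, h2⟩ h3
  simp only [switchPosterior, switchMarginal_eq_add pbar π k] at h2 ⊢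
  -- The benchmark `f` is the Bayesian density; `a = e^{-K} π(single k)` combines the loss of `pbar
  -- k` against it with the prior mass of never switching.
  refine tendsto_div_add_one (c := 1 + c)
    (a := (ENNReal.ofReal (Real.exp K))⁻¹ * π (SwitchParam.single k)) (by simp)
    (mul_ne_zero (by simp) h0.ne') (ENNReal.mul_ne_top (by simpa using Real.exp_pos K)
      (π.apply_ne_top _)) (fun n => (h2 n).2) (fun n => tsum_active_ne_le pbar hc k n _)
    (fun n => ?_) (fun n => (h2 n).1) h1
  have h4 := le_tsum_active_eq pbar π k n (initialSegment n ω)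
  refine le_trans ?_ h4
  -- With its positive prior weight, this density is a term of the finite switch marginal.
  have ha : (pbar k).joint n (initialSegment n ω) ≠ ∞ := fun h => by
    rw [h, ENNReal.top_mul h0.ne', top_le_iff] at h4
    exact (h2 n).2 (by rw [h4, top_add])
  have h5 := ENNReal.le_mul_of_neg_log_add_log_le ha (h2 n).1 (h3 n)
  rw [mul_right_comm]
  gcongr
  rwa [mul_comm, ← div_eq_mul_inv, ENNReal.div_le_iff' hE ENNReal.ofReal_ne_top]

end Consistency

theorem mainTheorem6 {d : ℕ} (S : Set (EuclideanSpace ℝ (Fin d))) (hS : MeasurableSet S)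
    (M : ℕ+ → ParametricModel (referenceMeasure S))
    (hM : ∀ k, volume ((M k).param \ interior (M k).param) = 0)
    (pbar : ℕ+ → PredictionStrategy (referenceMeasure S)) (π : PMF SwitchParam)
    (hcond : BayesComparisonCondition M pbar π) (kstar : ℕ+) :
    ∀ᵐ θstar ∂(M kstar).lebesgue, ∀ᵐ ω ∂((M kstar).strategy θstar).law,
      Tendsto (fun n => switchPosterior pbar π n (initialSegment n ω) kstar) atTop (𝓝 1) := by
  have := hS.standardBorel
  exact switchPosterior_tendsto_one M hM pbar π hcond kstar
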